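/- All graphs are simple and $d$ denotes distance. For a vertex $v$ of a finite connected graph $G$ and an integer $r \ge 1$, let $M_r(v)=\{w\in V(G): d(v,w)\le r\}$, and let the ball $G_r(v)$ be the subgraph of $G$ induced by $M_r(v)$. A vertex $u$ of $G_r(v)$ is called an interior vertex of $G_r(v)$ if $G_1(u)$ is a subgraph of $G_r(v)$. Let $\kappa(H)$ denote the connectivity of a finite graph $H$, that is, the smallest number of vertices whose removal turns $H$ into a disconnected graph or a trivial graph (one with at most one vertex). A graph is 2-connected if it has at least three vertices and remains connected after the removal of any set of at most one vertex. Write $d(u)$ for the degree of $u$ in $G$. Theorem. Let $G$ be a connected finite graph on at least three vertices such that every ball of radius $3$ in $G$ is 2-connected and $$d(u)\ \ge\ \tfrac13\bigl(|M_3(v)|+\kappa(G_3(v))\bigr)$$ for every vertex $v\in V(G)$ and for each interior vertex $u$ of $G_3(v)$. Then $G$ is Hamiltonian, i.e. $G$ has a cycle containing every vertex of $G$. -/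

import Mathlib

namespace SimpleGraph

variable {V : Type*}

/-- The set `M_r(u)` of all vertices at distance at most `r` from `u`. -/
def closedBall (G : SimpleGraph V) (u : V) (r : ℕ) : Set V :=
  {v | G.edist u v ≤ (r : ℕ∞)}

/-- The ball `G_r(u)` of radius `r` centered at `u`: the subgraph of `G` induced by `M_r(u)`. -/
abbrev ballGraph (G : SimpleGraph V) (u : V) (r : ℕ) : SimpleGraph (G.closedBall u r) :=
  G.induce (G.closedBall u r)

/-- `v` is an interior vertex of the ball `G_r(u)`: it is a vertex of `G_r(u)` and the ball `G_1(v)`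
is a subgraph of `G_r(u)`. Both balls are induced subgraphs of `G`, so the latter is inclusion of
vertex sets. -/
def IsInteriorVertex (G : SimpleGraph V) (u : V) (r : ℕ) (v : V) : Prop :=
  v ∈ G.closedBall u r ∧ G.closedBall v 1 ⊆ G.closedBall u r

/-- The connectivity `κ(H)` of a finite graph `H`: the smallest number of vertices whose removal
leaves a graph that is disconnected or trivial (has at most one vertex). -/
noncomputable def vertexConnectivity (H : SimpleGraph V) : ℕ :=
  sInf {k : ℕ | ∃ S : Finset V, S.card = k ∧
    (¬ (H.induce ((S : Set V)ᶜ)).Preconnected ∨ ((S : Set V)ᶜ).Subsingleton)}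

/-- A finite graph `H` is `k`-connected if it has more than `k` vertices and it remains connected
whenever fewer than `k` vertices are removed. -/
def IsVertexConnected (H : SimpleGraph V) (k : ℕ) : Prop :=
  k < Nat.card V ∧ ∀ S : Finset V, S.card < k → (H.induce ((S : Set V)ᶜ)).Connected

end SimpleGraph

/-! Take a longest cycle, write u⁺ for the successor of u on it, and suppose that it misses a
vertex. Vertices at distance at most 2 from c are interior in the ball of radius 3 around c. Hence
any three of them, a, b, v, satisfy d(a) + d(b) + d(v) ≥ |M_3(c)| + κ, with κ ≥ 2 by
2-connectedness. By inclusion-exclusion, if at least d(v) vertices of the ball are adjacent neither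
to a nor to b, then a and b have at least κ common neighbours (`card_inter`, `exists_common`). This
turns nonadjacencies forced by maximality into short distances.

The central count is `not_two_attachments`. Let an off-cycle path from p to q attach at x ≠ y, with
x⁺ and y⁺ at distance at most 2. Shifted neighbours of x⁺, neighbours of y⁺, p with its off-cycle
neighbours, and one substitute for each further cycle neighbour of p are disjoint subsets of
M_3(x⁺). They have too many vertices in total. The substitutes exist unless p can replace some u⁺ on
the cycle while u⁺ has no off-cycle neighbour.

That obstruction is removed by `exists_adj_off`: a vertex off a longest cycle has a neighbour off
it. This is where κ itself matters, through a minimum separator of a ball. Consequently an off-cycle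
vertex has at most one neighbour on the cycle (`attachment_unique`).

Finally, in `mem_longest`, let R be an off-cycle component attached at x. Since the ball around x
stays connected without x, R has a second attachment y. The common-neighbour argument, applied in
two successive balls, brings x⁺ and y⁺ within distance 2, and the count gives the contradiction. -/

namespace SimpleGraph

/-! ### Cycles as vertex lists, with `List.formPerm` as the successor map -/

section CyclicLists

variable {V : Type*} {G : SimpleGraph V}

/-- `l` lists the vertices of a walk from `a` to `b`. -/
def IsSeg (G : SimpleGraph V) (a b : V) (l : List V) : Prop :=
  l.IsChain G.Adj ∧ l.head? = some a ∧ l.getLast? = some b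

/-- `l` lists, without repetition, the vertices of a closed walk. Lists of length at least three
are exactly the vertex lists of cycles. -/
def IsCyclicList (G : SimpleGraph V) (l : List V) : Prop :=
  l.Nodup ∧ ∃ a b, G.IsSeg a b l ∧ G.Adj b a

/-- `l` is a cyclic list of maximum length. -/
def IsLongestCyclicList (G : SimpleGraph V) (l : List V) : Prop :=
  G.IsCyclicList l ∧ ∀ l', G.IsCyclicList l' → l'.length ≤ l.length

theorem IsSeg.head_mem {a b : V} {l : List V} (h : G.IsSeg a b l) : a ∈ l :=
  List.mem_of_head? h.2.1

theorem IsSeg.last_mem {a b : V} {l : List V} (h : G.IsSeg a b l) : b ∈ l :=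
  List.mem_of_getLast? h.2.2

theorem IsSeg.singleton (a : V) : G.IsSeg a a [a] := by simp [IsSeg]

theorem IsSeg.pair {a b : V} (h : G.Adj a b) : G.IsSeg a b [a, b] := by simp [IsSeg, h]

theorem IsSeg.reverse {a b : V} {l : List V} (h : G.IsSeg a b l) : G.IsSeg b a l.reverse := by
  obtain ⟨h1, h2, h3⟩ := h
  refine ⟨?_, by simpa using h3, by simpa using h2⟩
  rw [List.isChain_reverse]
  exact h1.imp fun _ _ hab => hab.symm

theorem IsSeg.append {a b c d : V} {l m : List V} (hl : G.IsSeg a b l) (hm : G.IsSeg c d m)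
    (h : G.Adj b c) : G.IsSeg a d (l ++ m) := by
  obtain ⟨h1, h2, h3⟩ := hl
  obtain ⟨k1, k2, k3⟩ := hm
  refine ⟨?_, by simp [h2], by simp [k3]⟩
  rw [List.isChain_append]
  refine ⟨h1, k1, ?_⟩
  intro x hx y hy
  rw [h3] at hx; rw [k2] at hy
  simp only [Option.mem_def, Option.some.injEq] at hx hy
  subst hx; subst hy; exact h

theorem IsSeg.split {a b c : V} {r : List V} (h : G.IsSeg a b r) (hc : c ∈ r) (hcb : c ≠ b) :
    ∃ s t d, r = s ++ t ∧ G.IsSeg a c s ∧ G.IsSeg d b t ∧ G.Adj c d := by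
  obtain ⟨s, t, rfl⟩ := List.append_of_mem hc
  obtain ⟨h1, h2, h3⟩ := h
  cases t with
  | nil => simp at h3; exact absurd h3 hcb
  | cons d t =>
    have e : s ++ c :: d :: t = (s ++ [c]) ++ (d :: t) := by simp
    rw [e] at h1 h2 h3
    rw [List.isChain_append] at h1
    refine ⟨s ++ [c], d :: t, d, e, ⟨h1.1, ?_, by simp⟩, ⟨h1.2.1, by simp, ?_⟩,
      h1.2.2 c (by simp) d (by simp)⟩
    · rw [← h2]; cases s <;> simp
    · rw [← h3, List.getLast?_append, List.getLast?_cons]; rfl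

theorem IsCyclicList.ne_nil {l : List V} (h : G.IsCyclicList l) : l ≠ [] := by
  obtain ⟨_, a, b, hs, _⟩ := h
  exact List.ne_nil_of_mem hs.head_mem

/-- An edge counts as a cyclic list, so a longest one exists without first finding a cycle; length
at least three is recovered only once the list spans the graph. -/
theorem isCyclicList_of_adj {a b : V} (h : G.Adj a b) : G.IsCyclicList [a, b] :=
  ⟨by simp [h.ne], a, b, IsSeg.pair h, h.symm⟩

theorem exists_isLongestCyclicList [Fintype V] {a b : V} (h : G.Adj a b) :
    ∃ l, G.IsLongestCyclicList l := by
  have hb : ∀ n, (∃ l, G.IsCyclicList l ∧ l.length = n) → n ≤ Fintype.card V := by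
    rintro n ⟨l, hl, rfl⟩
    exact hl.1.length_le_card
  classical
  have hex : ∃ n, ∃ l, G.IsCyclicList l ∧ l.length = n := ⟨_, _, isCyclicList_of_adj h, rfl⟩
  obtain ⟨l, hl, hn⟩ := Nat.findGreatest_spec (P := fun n => ∃ l, G.IsCyclicList l ∧ l.length = n)
    (hb _ hex.choose_spec) hex.choose_spec
  refine ⟨l, hl, fun l' hl' => ?_⟩
  rw [hn]
  exact Nat.le_findGreatest (hb _ ⟨l', hl', rfl⟩) ⟨l', hl', rfl⟩

variable [DecidableEq V]

theorem formPerm_eq_of_head?_of_getLast? {a b : V} {r : List V} (h2 : r.head? = some a)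
    (h3 : r.getLast? = some b) : r.formPerm b = a := by
  cases r with
  | nil => simp at h2
  | cons c r =>
    simp only [List.head?_cons, Option.some.injEq] at h2
    subst h2
    have := List.formPerm_apply_getLast c r
    rw [List.getLast?_eq_some_getLast (by simp)] at h3
    simp only [Option.some.injEq] at h3
    rwa [h3] at this

theorem IsSeg.formPerm_last {a b : V} {r : List V} (h : G.IsSeg a b r) : r.formPerm b = a :=
  formPerm_eq_of_head?_of_getLast? h.2.1 h.2.2

/-- `formPerm` is invariant under rotation, so either cut between `s` and `t` can be made the place
where the list closes up. -/
theorem IsSeg.formPerm_append {a b c d : V} {l s t : List V} (hl : l.Nodup) (hr : l ~r s ++ t)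
    (hs : G.IsSeg a b s) (ht : G.IsSeg c d t) : l.formPerm b = c ∧ l.formPerm d = a := by
  constructor
  · rw [List.formPerm_eq_of_isRotated hl (hr.trans List.isRotated_append)]
    exact formPerm_eq_of_head?_of_getLast? (by simp [ht.2.1]) (by simp [hs.2.2])
  · rw [List.formPerm_eq_of_isRotated hl hr]
    exact formPerm_eq_of_head?_of_getLast? (by simp [hs.2.1]) (by simp [ht.2.2])

/-- A cyclic list can be cut open behind any of its vertices. -/
theorem IsCyclicList.open_at {l : List V} (h : G.IsCyclicList l) {x : V} (hx : x ∈ l) :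
    G.Adj x (l.formPerm x) ∧ ∃ r, l ~r r ∧ G.IsSeg (l.formPerm x) x r := by
  obtain ⟨hn, a, b, hs, hab⟩ := h
  by_cases hxb : x = b
  · subst hxb
    rw [hs.formPerm_last]
    exact ⟨hab, l, List.IsRotated.refl _, hs⟩
  · obtain ⟨s, t, d, rfl, h1, h2, h3⟩ := hs.split hx hxb
    rw [(h1.formPerm_append hn (List.IsRotated.refl _) h2).1]
    exact ⟨h3, t ++ s, List.isRotated_append, h2.append h1 hab⟩

theorem IsCyclicList.formPerm_mem {l : List V} {x : V} (hx : x ∈ l) :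
    l.formPerm x ∈ l := List.formPerm_apply_mem_of_mem hx

/-- A cyclic list falls into two segments when it is cut open behind two of its vertices. -/
theorem IsCyclicList.open_at_two {l : List V} (h : G.IsCyclicList l) {x y : V} (hx : x ∈ l)
    (hy : y ∈ l) (hxy : x ≠ y) : ∃ s t, l ~r s ++ t ∧ G.IsSeg (l.formPerm x) y s ∧
      G.IsSeg (l.formPerm y) x t := by
  obtain ⟨-, r, hr, hs⟩ := h.open_at hx
  obtain ⟨s, t, d, rfl, h1, h2, -⟩ := hs.split (hr.mem_iff.1 hy) hxy.symm
  refine ⟨s, t, hr, h1, ?_⟩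
  rwa [(h1.formPerm_append h.1 hr h2).1]

theorem IsSeg.split_formPerm {a b x : V} {l s t : List V} (hl : l.Nodup) (hr : l ~r s ++ t)
    (hs : G.IsSeg a b s) (hx : x ∈ s) (hxb : x ≠ b) :
    ∃ s₁ s₂, s = s₁ ++ s₂ ∧ G.IsSeg a x s₁ ∧ G.IsSeg (l.formPerm x) b s₂ ∧
      G.Adj x (l.formPerm x) := by
  obtain ⟨s₁, s₂, e, rfl, h1, h2, h3⟩ := hs.split hx hxb
  have hr' : l ~r s₂ ++ t ++ s₁ := by
    refine hr.trans ?_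
    rw [List.append_assoc, List.append_assoc]
    refine List.isRotated_append.trans ?_
    rw [List.append_assoc]
  have : l.formPerm x = e := by
    rw [List.formPerm_eq_of_isRotated hl hr']
    exact formPerm_eq_of_head?_of_getLast? (by simp [h2.2.1]) (by simp [h1.2.2])
  rw [this]
  exact ⟨s₁, s₂, rfl, h1, h2, h3⟩

theorem IsCyclicList.isHamiltonian [Fintype V] {l : List V} (h : G.IsCyclicList l)
    (hl : ∀ v, v ∈ l) (hc : 3 ≤ Fintype.card V) : G.IsHamiltonian := by
  intro _
  obtain ⟨hn, a, b, ⟨h1, h2, h3⟩, hab⟩ := h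
  have hne : l ≠ [] := by rintro rfl; simp at h2
  have hlen : l.length = Fintype.card V := by
    rw [← List.toFinset_card_of_nodup hn, ← Finset.card_univ]
    congr 1; ext v; simp [hl v]
  have ha : l.head hne = a := by
    rw [List.head?_eq_some_head hne] at h2; simpa using h2
  have hb : l.getLast hne = b := by
    rw [List.getLast?_eq_some_getLast hne] at h3; simpa using h3
  let w : G.Walk a b := (Walk.ofSupport l hne h1).copy ha hb
  have hws : w.support = l := by simp [w]
  have hwp : w.IsPath := by rw [Walk.isPath_def, hws]; exact hn
  have hwl : w.length = Fintype.card V - 1 := by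
    rw [← hlen, ← hws, Walk.length_support]; rfl
  refine ⟨b, Walk.cons hab w, ?_⟩
  rw [Walk.isHamiltonianCycle_iff_isCycle_and_length_eq]
  refine ⟨?_, by simp [hwl]; omega⟩
  rw [Walk.cons_isCycle_iff]
  refine ⟨hwp, fun he => ?_⟩
  -- The closing edge is new: a path containing the edge between its own ends has length one, but
  -- this one spans at least three vertices.
  have := hwp.length_eq_one_of_mem_edges (by rwa [Sym2.eq_swap] at he)
  omega

end CyclicLists

/-! ### Reroutings excluded by maximality -/

section LongestCyclicLists

variable {V : Type*} {G : SimpleGraph V}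

/-- `P` lists, without repetition, the vertices of a path from `p` to `q` that avoids `l`. -/
def IsOffSeg (G : SimpleGraph V) (l : List V) (p q : V) (P : List V) : Prop :=
  G.IsSeg p q P ∧ P.Nodup ∧ ∀ v ∈ P, v ∉ l

theorem IsOffSeg.singleton {l : List V} {p : V} (hp : p ∉ l) : G.IsOffSeg l p p [p] :=
  ⟨IsSeg.singleton p, by simp, by simpa using hp⟩

theorem IsOffSeg.pair {l : List V} {p q : V} (hp : p ∉ l) (hq : q ∉ l) (h : G.Adj p q) :
    G.IsOffSeg l p q [p, q] :=
  ⟨IsSeg.pair h, by simp [h.ne], by simp [hp, hq]⟩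

theorem IsOffSeg.reverse {l P : List V} {p q : V} (h : G.IsOffSeg l p q P) :
    G.IsOffSeg l q p P.reverse :=
  ⟨h.1.reverse, by simpa using h.2.1, by simpa using h.2.2⟩

/-- The common contradiction of the exclusions below: each forbidden adjacency yields a closed walk
through all of `l` and the nonempty detour `P`. -/
theorem IsLongestCyclicList.not_perm_append {l l' P : List V} {a b : V}
    (hl : G.IsLongestCyclicList l) (hP : P ≠ []) (hn : P.Nodup) (hd : ∀ v ∈ P, v ∉ l)
    (hs : G.IsSeg a b l') (hab : G.Adj b a) : ¬ l'.Perm (l ++ P) := by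
  intro hp
  have hnd : (l ++ P).Nodup := by
    rw [List.nodup_append]
    exact ⟨hl.1.1, hn, fun u hu v hv huv => hd v hv (huv ▸ hu)⟩
  have := hl.2 l' ⟨hp.nodup_iff.2 hnd, a, b, hs, hab⟩
  rw [hp.length_eq, List.length_append] at this
  have := List.length_pos_iff.2 hP
  omega

theorem IsOffSeg.exists_of_mem {l P : List V} {p q w : V} (hP : G.IsOffSeg l p q P)
    (hw : w ∈ P) : ∃ P', G.IsOffSeg l p w P' := by
  by_cases hwq : w = q
  · exact ⟨P, hwq ▸ hP⟩
  · obtain ⟨s, t, d, rfl, h1, -, -⟩ := hP.1.split hw hwq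
    exact ⟨s, h1, (List.nodup_append.1 hP.2.1).1,
      fun v hv => hP.2.2 v (List.mem_append_left _ hv)⟩

theorem IsOffSeg.exists_of_adj {l P : List V} {p q w : V} (hP : G.IsOffSeg l p q P)
    (hqw : G.Adj q w) (hw : w ∉ l) : ∃ P', G.IsOffSeg l p w P' := by
  by_cases hwP : w ∈ P
  · exact hP.exists_of_mem hwP
  · refine ⟨P ++ [w], hP.1.append (IsSeg.singleton w) hqw, ?_, ?_⟩
    · rw [List.nodup_append]
      refine ⟨hP.2.1, by simp, ?_⟩
      rintro a ha b hb rfl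
      exact hwP (by simp at hb; exact hb ▸ ha)
    · intro v hv
      rcases List.mem_append.1 hv with hv | hv
      · exact hP.2.2 v hv
      · simp at hv; exact hv ▸ hw

variable [DecidableEq V]

/-- Otherwise `P` could be inserted between x and x⁺. -/
theorem IsLongestCyclicList.not_adj_succ {l P : List V} {p q x : V}
    (hl : G.IsLongestCyclicList l) (hP : G.IsOffSeg l p q P) (hx : x ∈ l) (hxp : G.Adj x p) :
    ¬ G.Adj q (l.formPerm x) := by
  intro h
  obtain ⟨-, r, hr, hs⟩ := hl.1.open_at hx
  refine hl.not_perm_append (List.ne_nil_of_mem hP.1.head_mem) hP.2.1 hP.2.2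
    (hs.append hP.1 hxp) h ?_
  exact hr.perm.symm.append_right P

/-- Otherwise the cycle runs backwards from y to x⁺, jumps to y⁺, continues to x and closes through
`P`. -/
theorem IsLongestCyclicList.not_adj_succ_succ {l P : List V} {p q x y : V}
    (hl : G.IsLongestCyclicList l) (hP : G.IsOffSeg l p q P) (hx : x ∈ l) (hy : y ∈ l)
    (hxy : x ≠ y) (hxp : G.Adj x p) (hyq : G.Adj y q) :
    ¬ G.Adj (l.formPerm x) (l.formPerm y) := by
  intro h
  obtain ⟨s, t, hr, hs, ht⟩ := hl.1.open_at_two hx hy hxy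
  refine hl.not_perm_append (List.ne_nil_of_mem hP.1.head_mem) hP.2.1 hP.2.2
    ((hs.reverse.append ht h).append hP.1 hxp) hyq.symm ?_
  rw [List.perm_iff_count]
  intro a
  simp [List.count_append, hr.perm.count_eq]
  omega

/-- The same rerouting, with the jump from x⁺ to y⁺ made through w. The vertex w is not on `P`,
since the part of `P` up to w would fit between x and x⁺. -/
theorem IsLongestCyclicList.not_common_succ {l P : List V} {p q x y w : V}
    (hl : G.IsLongestCyclicList l) (hP : G.IsOffSeg l p q P) (hx : x ∈ l) (hy : y ∈ l)
    (hxy : x ≠ y) (hxp : G.Adj x p) (hyq : G.Adj y q) (hw : w ∉ l)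
    (hxw : G.Adj (l.formPerm x) w) : ¬ G.Adj (l.formPerm y) w := by
  intro h
  have hwP : w ∉ P := by
    intro hwP
    obtain ⟨P', hP'⟩ := hP.exists_of_mem hwP
    exact hl.not_adj_succ hP' hx hxp hxw.symm
  obtain ⟨s, t, hr, hs, ht⟩ := hl.1.open_at_two hx hy hxy
  refine hl.not_perm_append (P := w :: P) (by simp) (by simp [hwP, hP.2.1]) ?_
    (((hs.reverse.append (IsSeg.singleton w) hxw).append ht h.symm).append hP.1 hxp) hyq.symm ?_
  · simpa [hw] using hP.2.2
  rw [List.perm_iff_count]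
  intro a
  simp [List.count_append, List.count_cons, hr.perm.count_eq]
  omega

/-- Otherwise the cycle runs from a back to x⁺, over to a⁺ and on to y, through `P` reversed to x,
back to y⁺ and home to a. This makes the neighbours of y⁺ on `s` disjoint from the predecessors of
the neighbours of x⁺ there. -/
theorem IsLongestCyclicList.not_cross {l P s t : List V} {p q x y a : V}
    (hl : G.IsLongestCyclicList l) (hP : G.IsOffSeg l p q P)
    (hxp : G.Adj x p) (hyq : G.Adj y q) (hr : l ~r s ++ t) (hs : G.IsSeg (l.formPerm x) y s)
    (ht : G.IsSeg (l.formPerm y) x t) (ha : a ∈ s) (hay : a ≠ y)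
    (h : G.Adj (l.formPerm y) a) : ¬ G.Adj (l.formPerm x) (l.formPerm a) := by
  intro h'
  obtain ⟨s₁, s₂, rfl, h1, h2, -⟩ := hs.split_formPerm hl.1.1 hr ha hay
  refine hl.not_perm_append (P := P) (List.ne_nil_of_mem hP.1.head_mem) hP.2.1 hP.2.2
    (((h1.reverse.append h2 h').append hP.reverse.1 hyq).append ht.reverse hxp.symm) h ?_
  rw [List.perm_iff_count]
  intro a
  simp [List.count_append, hr.perm.count_eq]
  omega

/-- Two vertices of a longest cyclic list with a common neighbour `p` off the list: if the
successor of one is adjacent to the second successor of the other, then `p` can take the place of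
a vertex of the list. -/
theorem IsLongestCyclicList.exists_exchange {l : List V} {p z u : V}
    (hl : G.IsLongestCyclicList l) (hp : p ∉ l) (hz : z ∈ l) (hu : u ∈ l) (hzu : z ≠ u)
    (hzp : G.Adj z p) (hup : G.Adj u p)
    (h : G.Adj (l.formPerm z) (l.formPerm (l.formPerm u))) :
    ∃ l', G.IsLongestCyclicList l' ∧ ∀ v, v ∈ l' ↔ v = p ∨ (v ∈ l ∧ v ≠ l.formPerm u) := by
  have hP := IsOffSeg.singleton (G := G) hp
  obtain ⟨s, t, hr, hs, ht⟩ := hl.1.open_at_two hz hu hzu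
  have hne : l.formPerm u ≠ z := by
    intro e
    exact hl.not_adj_succ hP hu hup (e ▸ hzp.symm)
  obtain ⟨t₁, t₂, rfl, h1, h2, -⟩ := ht.split_formPerm hl.1.1
    (hr.trans List.isRotated_append) ht.head_mem hne
  have ht1 : t₁ = [l.formPerm u] := by
    have hn : (s ++ (t₁ ++ t₂)).Nodup := hr.perm.nodup_iff.1 hl.1.1
    have hn1 : t₁.Nodup := ((List.nodup_append.1 (List.nodup_append.1 hn).2.1)).1
    obtain ⟨-, k1, k2⟩ := h1
    cases t₁ with
    | nil => simp at k1
    | cons b t₁ =>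
      simp only [List.head?_cons, Option.some.injEq] at k1
      subst k1
      cases t₁ with
      | nil => rfl
      | cons c t₁ =>
        rw [List.getLast?_cons_cons] at k2
        exact absurd (List.mem_of_getLast? k2) (List.nodup_cons.1 hn1).1
  subst ht1
  have hseg := (hs.reverse.append h2 h).append (IsSeg.singleton p) hzp
  have hperm : (p :: l).Perm (l.formPerm u :: (s.reverse ++ t₂ ++ [p])) := by
    rw [List.perm_iff_count]
    intro a
    simp [List.count_append, List.count_cons, hr.perm.count_eq]
    omega
  have hn : (l.formPerm u :: (s.reverse ++ t₂ ++ [p])).Nodup := by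
    rw [← hperm.nodup_iff]
    simp [hp, hl.1.1]
  rw [List.nodup_cons] at hn
  refine ⟨_, ⟨⟨hn.2, _, _, hseg, hup.symm⟩, fun l' hl' => ?_⟩, fun v => ?_⟩
  · have := hperm.length_eq
    simp only [List.length_cons] at this
    have := hl.2 l' hl'
    omega
  · have h1 := hperm.mem_iff (a := v)
    rw [List.mem_cons, List.mem_cons] at h1
    have h3 : l.formPerm u ≠ p := fun e => hp (e ▸ IsCyclicList.formPerm_mem hu)
    constructor
    · intro hv
      have : v ≠ l.formPerm u := fun e => hn.1 (e ▸ hv)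
      tauto
    · rintro (rfl | ⟨hv, hv'⟩)
      · simp
      · tauto

end LongestCyclicLists

/-! ### Balls, their separators and their connectivity -/

section Balls

variable {V : Type*} {G : SimpleGraph V}

theorem mem_closedBall_iff_exists_walk {c v : V} {r : ℕ} :
    v ∈ G.closedBall c r ↔ ∃ w : G.Walk c v, w.length ≤ r := by
  constructor
  · intro h
    have h' : G.edist c v ≤ (r : ℕ∞) := h
    obtain ⟨w, hw⟩ := G.exists_walk_of_edist_ne_top (u := c) (v := v)
      (ne_top_of_le_ne_top (ENat.natCast_ne_top r) h')
    refine ⟨w, ?_⟩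
    rw [← hw] at h'
    exact_mod_cast h'
  · rintro ⟨w, hw⟩
    exact (Walk.edist_le w).trans (by exact_mod_cast hw)

theorem mem_closedBall_self (c : V) (r : ℕ) : c ∈ G.closedBall c r :=
  mem_closedBall_iff_exists_walk.2 ⟨Walk.nil, by simp⟩

theorem mem_closedBall_comm {c v : V} {r : ℕ} : v ∈ G.closedBall c r ↔ c ∈ G.closedBall v r := by
  simp [closedBall, edist_comm]

theorem closedBall_mono (c : V) {r s : ℕ} (h : r ≤ s) : G.closedBall c r ⊆ G.closedBall c s := by
  intro v hv
  rw [mem_closedBall_iff_exists_walk] at *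
  obtain ⟨w, hw⟩ := hv
  exact ⟨w, hw.trans h⟩

theorem mem_closedBall_of_adj {c a b : V} {r : ℕ} (h : a ∈ G.closedBall c r) (hab : G.Adj a b) :
    b ∈ G.closedBall c (r + 1) := by
  rw [mem_closedBall_iff_exists_walk] at *
  obtain ⟨w, hw⟩ := h
  exact ⟨w.concat hab, by simpa using hw⟩

theorem adj_mem_closedBall_one {c a : V} (h : G.Adj c a) : a ∈ G.closedBall c 1 :=
  mem_closedBall_of_adj (mem_closedBall_self c 0) h

theorem adj_adj_mem_closedBall_two {c a b : V} (h : G.Adj c a) (h' : G.Adj a b) :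
    b ∈ G.closedBall c 2 :=
  mem_closedBall_of_adj (adj_mem_closedBall_one h) h'

theorem exists_adj_mem_closedBall {c b : V} {r : ℕ} (h : b ∈ G.closedBall c (r + 1))
    (hb : b ≠ c) : ∃ a ∈ G.closedBall c r, G.Adj a b := by
  rw [mem_closedBall_comm, mem_closedBall_iff_exists_walk] at h
  obtain ⟨w, hw⟩ := h
  cases w with
  | nil => exact absurd rfl hb
  | cons hab w =>
    exact ⟨_, mem_closedBall_comm.1 (mem_closedBall_iff_exists_walk.2 ⟨w, by simpa using hw⟩),
      hab.symm⟩

theorem isInteriorVertex_of_mem_closedBall {c u : V} {r : ℕ} (h : u ∈ G.closedBall c r) :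
    G.IsInteriorVertex c (r + 1) u := by
  refine ⟨closedBall_mono c (Nat.le_succ r) h, fun v hv => ?_⟩
  by_cases huv : v = u
  · exact huv ▸ closedBall_mono c (Nat.le_succ r) h
  · obtain ⟨a, ha, hav⟩ := exists_adj_mem_closedBall (r := 0) hv huv
    obtain ⟨w, hw⟩ := mem_closedBall_iff_exists_walk.1 ha
    obtain rfl := Walk.eq_of_length_eq_zero (Nat.le_zero.1 hw)
    exact mem_closedBall_of_adj h hav

/-- `S` separates `P` from `Q` in the ball of radius `r` around `z`. -/
structure IsBallSeparation (G : SimpleGraph V) (z : V) (r : ℕ) (S P Q : Set V) : Prop where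
  union : S ∪ P ∪ Q = G.closedBall z r
  disjoint_left : Disjoint S P
  disjoint_right : Disjoint S Q
  disjoint : Disjoint P Q
  nonempty_left : P.Nonempty
  nonempty_right : Q.Nonempty
  not_adj : ∀ a ∈ P, ∀ b ∈ Q, ¬ G.Adj a b

theorem IsBallSeparation.symm {z : V} {r : ℕ} {S P Q : Set V} (h : G.IsBallSeparation z r S P Q) :
    G.IsBallSeparation z r S Q P where
  union := by rw [← h.union, Set.union_right_comm]
  disjoint_left := h.disjoint_right
  disjoint_right := h.disjoint_left
  disjoint := h.disjoint.symm
  nonempty_left := h.nonempty_right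
  nonempty_right := h.nonempty_left
  not_adj a ha b hb hab := h.not_adj b hb a ha hab.symm

theorem IsBallSeparation.vertexConnectivity_le [Finite V] {z : V} {r : ℕ} {S P Q : Set V}
    (h : G.IsBallSeparation z r S P Q) : (G.ballGraph z r).vertexConnectivity ≤ S.ncard := by
  classical
  have : Fintype V := Fintype.ofFinite V
  have hSB : S ⊆ G.closedBall z r := by
    rw [← h.union]; exact Set.subset_union_left.trans Set.subset_union_left
  have hPB : P ⊆ G.closedBall z r := by
    rw [← h.union]; exact Set.subset_union_right.trans Set.subset_union_left
  have hQB : Q ⊆ G.closedBall z r := by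
    rw [← h.union]; exact Set.subset_union_right
  let S' : Finset (G.closedBall z r) := Finset.univ.filter (fun v => v.1 ∈ S)
  have hcard : S'.card = S.ncard := by
    rw [← Set.ncard_coe_finset, ← Set.ncard_image_of_injective _ Subtype.val_injective]
    congr 1
    ext v
    simp only [S', Finset.coe_filter, Finset.mem_univ, true_and, Set.mem_image, Set.mem_ofPred_eq,
      Subtype.exists, exists_and_left, exists_prop, exists_eq_right_right]
    exact ⟨fun hv => hv.1, fun hv => ⟨hv, hSB hv⟩⟩
  refine Nat.sInf_le ⟨S', hcard, Or.inl fun hpre => ?_⟩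
  obtain ⟨a, ha⟩ := h.nonempty_left
  obtain ⟨b, hb⟩ := h.nonempty_right
  have haS : a ∉ S := fun hs => Set.disjoint_left.1 h.disjoint_left hs ha
  have hbS : b ∉ S := fun hs => Set.disjoint_left.1 h.disjoint_right hs hb
  obtain ⟨w⟩ := hpre ⟨⟨a, hPB ha⟩, by simpa [S'] using haS⟩ ⟨⟨b, hQB hb⟩, by simpa [S'] using hbS⟩
  obtain ⟨d, -, hd1, hd2⟩ := w.exists_boundary_dart {v | v.1.1 ∈ P} ha
    (fun hbP => Set.disjoint_left.1 h.disjoint hbP hb)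
  have hadj : G.Adj d.fst.1.1 d.snd.1.1 := d.adj
  have h2 := d.snd.1.2
  have h3 : d.snd.1.1 ∉ S := by simpa [S'] using d.snd.2
  rcases h.union.ge h2 with (h2 | h2) | h2
  · exact h3 h2
  · exact hd2 h2
  · exact h.not_adj _ hd1 _ h2 hadj

/-- In a noncomplete ball the minimum defining the connectivity is attained by a genuine separator,
not by leaving a trivial graph. -/
theorem exists_isBallSeparation [Finite V] {z a b : V} {r : ℕ} (ha : a ∈ G.closedBall z r)
    (hb : b ∈ G.closedBall z r) (hne : a ≠ b) (hab : ¬ G.Adj a b) :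
    ∃ S P Q, G.IsBallSeparation z r S P Q ∧
      S.ncard = (G.ballGraph z r).vertexConnectivity := by
  classical
  have : Fintype V := Fintype.ofFinite V
  have hex : (G.ballGraph z r).vertexConnectivity ∈ {k : ℕ | ∃ S : Finset (G.closedBall z r),
      S.card = k ∧ (¬ ((G.ballGraph z r).induce ((S : Set _)ᶜ)).Preconnected ∨
        ((S : Set (G.closedBall z r))ᶜ).Subsingleton)} := by
    refine Nat.sInf_mem ⟨_, Finset.univ, rfl, Or.inr ?_⟩
    simp
  obtain ⟨S, hS, hS'⟩ := hex
  rcases hS' with hS' | hS'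
  · have : ∃ u v, ¬ ((G.ballGraph z r).induce ((S : Set (G.closedBall z r))ᶜ)).Reachable u v := by
      by_contra! hcon
      exact hS' hcon
    obtain ⟨u, v, huv⟩ := this
    let f : ((S : Set (G.closedBall z r))ᶜ : Set (G.closedBall z r)) → V := fun w => w.1.1
    have hf : Function.Injective f := Subtype.val_injective.comp Subtype.val_injective
    let R := {w | ((G.ballGraph z r).induce ((S : Set (G.closedBall z r))ᶜ)).Reachable u w}
    refine ⟨Subtype.val '' (S : Set (G.closedBall z r)), f '' R, f '' Rᶜ,
      ⟨?_, ?_, ?_, ?_, ⟨_, u, Reachable.refl u, rfl⟩, ⟨_, v, huv, rfl⟩, ?_⟩, ?_⟩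
    · rw [Set.union_assoc, ← Set.image_union, Set.union_compl_self]
      ext w
      constructor
      · rintro (⟨w, -, rfl⟩ | ⟨w, -, rfl⟩)
        · exact w.2
        · exact w.1.2
      · intro hw
        by_cases hwS : (⟨w, hw⟩ : G.closedBall z r) ∈ S
        · exact Or.inl ⟨_, hwS, rfl⟩
        · exact Or.inr ⟨⟨⟨w, hw⟩, hwS⟩, trivial, rfl⟩
    · rw [Set.disjoint_left]
      rintro _ ⟨w, hw, rfl⟩ ⟨w', -, hww⟩
      exact w'.2 (Subtype.val_injective hww ▸ hw)
    · rw [Set.disjoint_left]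
      rintro _ ⟨w, hw, rfl⟩ ⟨w', -, hww⟩
      exact w'.2 (Subtype.val_injective hww ▸ hw)
    · exact (Set.disjoint_image_iff hf).2 disjoint_compl_right
    · rintro _ ⟨w, hw, rfl⟩ _ ⟨w', hw', rfl⟩ hadj
      refine hw' (Reachable.trans hw (Adj.reachable ?_))
      exact hadj
    · rw [Set.ncard_image_of_injective _ Subtype.val_injective, Set.ncard_coe_finset, hS]
  · exfalso
    -- Leaving at most one vertex costs at least |M_r(z)| - 1 deletions, whereas deleting all but a
    -- and b already separates with |M_r(z)| - 2.
    have hsep : G.IsBallSeparation z r (G.closedBall z r \ {a, b}) {a} {b} := by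
      refine ⟨?_, ?_, ?_, by simpa using hne, by simp, by simp, by simpa using hab⟩
      · ext w
        simp only [Set.mem_union, Set.mem_sdiff, Set.mem_insert_iff, Set.mem_singleton_iff]
        constructor
        · rintro ((h | rfl) | rfl)
          exacts [h.1, ha, hb]
        · tauto
      · simp
      · simp
    have h1 := hsep.vertexConnectivity_le
    rw [← hS, Set.ncard_sdiff (by intro w; simp; rintro (rfl | rfl) <;> assumption),
      Set.ncard_pair hne] at h1
    have h2 : ((S : Set (G.closedBall z r))ᶜ).ncard ≤ 1 := Set.ncard_le_one_iff_subsingleton.2 hS'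
    have h3 := Set.ncard_add_ncard_compl (S : Set (G.closedBall z r))
    rw [Set.ncard_coe_finset] at h3
    have h4 : Nat.card (G.closedBall z r) = (G.closedBall z r).ncard := rfl
    have h5 : ({a, b} : Set V).ncard ≤ (G.closedBall z r).ncard :=
      Set.ncard_le_ncard (by intro w; simp; rintro (rfl | rfl) <;> assumption)
    rw [Set.ncard_pair hne] at h5
    omega

theorem two_le_vertexConnectivity {W : Type*} [Finite W] {H : SimpleGraph W}
    (h : H.IsVertexConnected 2) : 2 ≤ H.vertexConnectivity := by
  classical
  have : Fintype W := Fintype.ofFinite W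
  refine le_csInf ⟨_, Finset.univ, rfl, Or.inr (by simp)⟩ ?_
  rintro k ⟨S, rfl, hS⟩
  by_contra! hlt
  rcases hS with hS | hS
  · exact hS (h.2 S hlt).preconnected
  · have h2 : ((S : Set W)ᶜ).ncard ≤ 1 := Set.ncard_le_one_iff_subsingleton.2 hS
    have h3 := Set.ncard_add_ncard_compl (S : Set W)
    rw [Set.ncard_coe_finset] at h3
    have := h.1
    omega

end Balls

/-! ### The degree condition, common neighbours and neighbours off the cycle -/

section LocalDegree

variable {V : Type*} [Fintype V] {G : SimpleGraph V}

theorem card_le_ncard_closedBall {c : V} {r : ℕ} {T : Finset V}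
    (h : ∀ v ∈ T, v ∈ G.closedBall c r) : T.card ≤ (G.closedBall c r).ncard := by
  rw [← Set.ncard_coe_finset]
  exact Set.ncard_le_ncard h

variable [DecidableRel G.Adj]

/-- The local degree condition: every ball of radius `3` has connectivity at least two, and three
times the degree of a vertex at distance at most `2` from the centre is at least the sum of the
order and the connectivity of the ball. -/
structure BallDegreeCondition (G : SimpleGraph V) [DecidableRel G.Adj] : Prop where
  two_le : ∀ c, 2 ≤ (G.ballGraph c 3).vertexConnectivity
  degree : ∀ c u, u ∈ G.closedBall c 2 →
    (G.closedBall c 3).ncard + (G.ballGraph c 3).vertexConnectivity ≤ 3 * G.degree u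

theorem mem_closedBall_of_mem_neighborFinset {c a w : V} {r : ℕ} (ha : a ∈ G.closedBall c r)
    (hw : w ∈ G.neighborFinset a) : w ∈ G.closedBall c (r + 1) :=
  mem_closedBall_of_adj ha ((G.mem_neighborFinset a w).1 hw)

/-- The neighbours of v all lie in the ball and cut v off from b. -/
theorem vertexConnectivity_le_degree {z v b : V} {r : ℕ} (hv : v ∈ G.closedBall z r)
    (hb : b ∈ G.closedBall z (r + 1)) (hne : b ≠ v) (hvb : ¬ G.Adj v b) :
    (G.ballGraph z (r + 1)).vertexConnectivity ≤ G.degree v := by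
  have hsep : G.IsBallSeparation z (r + 1) (G.neighborSet v) {v}
      (G.closedBall z (r + 1) \ insert v (G.neighborSet v)) := by
    refine ⟨?_, by simp, ?_, by simp, by simp, ⟨b, hb, by simp [hne, hvb]⟩, ?_⟩
    · ext w
      simp only [Set.mem_union, Set.mem_sdiff, Set.mem_insert_iff, Set.mem_singleton_iff,
        mem_neighborSet]
      constructor
      · rintro ((h | rfl) | h)
        · exact mem_closedBall_of_adj hv h
        · exact closedBall_mono z (Nat.le_succ r) hv
        · exact h.1
      · tauto
    · rw [Set.disjoint_left]
      intro w hw hw'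
      exact hw'.2 (Set.mem_insert_of_mem _ hw)
    · rintro a rfl w hw hadj
      exact hw.2 (Set.mem_insert_of_mem _ hadj)
  refine hsep.vertexConnectivity_le.trans (le_of_eq ?_)
  rw [← card_neighborFinset_eq_degree, ← Set.ncard_coe_finset, coe_neighborFinset]

variable [DecidableEq V]

/-- Inclusion-exclusion for N(b) and N(a) ∪ I inside M_3(c), combined with the sum of the degree
bounds for a, b and v. The set `I` compensates for d(v). -/
theorem BallDegreeCondition.card_inter (hG : G.BallDegreeCondition) {c a b v : V}
    (ha : a ∈ G.closedBall c 2) (hb : b ∈ G.closedBall c 2) (hv : v ∈ G.closedBall c 2)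
    {I : Finset V} (hI : ∀ w ∈ I, w ∈ G.closedBall c 3) (hd : ∀ w ∈ I, ¬ G.Adj a w) :
    (G.ballGraph c 3).vertexConnectivity + I.card ≤
      (G.neighborFinset b ∩ (G.neighborFinset a ∪ I)).card + G.degree v := by
  have h1 : (G.neighborFinset a ∪ I).card = G.degree a + I.card := by
    rw [Finset.card_union_of_disjoint, card_neighborFinset_eq_degree]
    rw [Finset.disjoint_left]
    intro w hw hwI
    exact hd w hwI ((G.mem_neighborFinset a w).1 hw)
  have h2 := Finset.card_union_add_card_inter (G.neighborFinset b) (G.neighborFinset a ∪ I)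
  rw [h1, card_neighborFinset_eq_degree] at h2
  have h3 : (G.neighborFinset b ∪ (G.neighborFinset a ∪ I)).card ≤ (G.closedBall c 3).ncard := by
    apply card_le_ncard_closedBall
    intro w hw
    rw [Finset.mem_union, Finset.mem_union] at hw
    rcases hw with hw | hw | hw
    · exact mem_closedBall_of_mem_neighborFinset hb hw
    · exact mem_closedBall_of_mem_neighborFinset ha hw
    · exact hI w hw
  have := hG.degree c a ha
  have := hG.degree c b hb
  have := hG.degree c v hv
  omega

/-- If the vertices of a large set `I` are neighbours neither of `a` nor of `b`, then `a` and `b`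
have a common neighbour. -/
theorem BallDegreeCondition.exists_common (hG : G.BallDegreeCondition) {c a b v : V}
    (ha : a ∈ G.closedBall c 2) (hb : b ∈ G.closedBall c 2) (hv : v ∈ G.closedBall c 2)
    {I : Finset V} (hI : ∀ w ∈ I, w ∈ G.closedBall c 3) (hcard : G.degree v ≤ I.card)
    (hda : ∀ w ∈ I, ¬ G.Adj a w) (hdb : ∀ w ∈ I, ¬ G.Adj b w) :
    ∃ w, G.Adj a w ∧ G.Adj b w := by
  have h1 := hG.card_inter ha hb hv hI hda
  have h2 := hG.two_le c
  obtain ⟨w, hw⟩ := Finset.card_pos.1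
    (show 0 < (G.neighborFinset b ∩ (G.neighborFinset a ∪ I)).card by omega)
  simp only [Finset.mem_inter, Finset.mem_union, mem_neighborFinset] at hw
  rcases hw.2 with h | h
  · exact ⟨w, h, hw.1⟩
  · exact absurd hw.1 (hdb w h)

/-- Under the local degree condition, every vertex `v` off a longest cyclic list has a neighbour
off the list. Otherwise `v` and the successors of its neighbours form a large independent set,
which contradicts the degree condition in a ball around the member of that set whose ball has the
least connectivity. -/
theorem BallDegreeCondition.exists_adj_off (hG : G.BallDegreeCondition) {l : List V}
    (hl : G.IsLongestCyclicList l) {v : V} (hv : v ∉ l) : ∃ w, w ∉ l ∧ G.Adj v w := by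
  by_contra! hcon
  have hNl : ∀ x, G.Adj v x → x ∈ l := fun x hx => by
    by_contra h
    exact hcon x h hx
  have hP := IsOffSeg.singleton (G := G) hv
  set I : Finset V := insert v ((G.neighborFinset v).image l.formPerm) with hI
  have hmem : ∀ a, a ∈ I ↔ a = v ∨ ∃ x, G.Adj v x ∧ l.formPerm x = a := by
    intro a; simp [hI]
  have hIcard : I.card = G.degree v + 1 := by
    rw [hI, Finset.card_insert_of_notMem, Finset.card_image_of_injective _ l.formPerm.injective,
      card_neighborFinset_eq_degree]
    simp only [Finset.mem_image, mem_neighborFinset, not_exists, not_and]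
    rintro x hx rfl
    exact hv (IsCyclicList.formPerm_mem (hNl x hx))
  have hvI : v ∈ I := (hmem v).2 (Or.inl rfl)
  have hind : ∀ a ∈ I, ∀ b ∈ I, ¬ G.Adj a b := by
    intro a ha b hb
    rcases (hmem a).1 ha with rfl | ⟨x, hx, rfl⟩ <;> rcases (hmem b).1 hb with rfl | ⟨y, hy, rfl⟩
    · exact G.irrefl
    · exact hl.not_adj_succ hP (hNl y hy) hy.symm
    · exact fun h => hl.not_adj_succ hP (hNl x hx) hx.symm h.symm
    · by_cases hxy : x = y
      · rw [hxy]; exact G.irrefl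
      · exact hl.not_adj_succ_succ hP (hNl x hx) (hNl y hy) hxy hx.symm hy.symm
  have hIv : ∀ a ∈ I, a ∈ G.closedBall v 2 := by
    intro a ha
    rcases (hmem a).1 ha with rfl | ⟨x, hx, rfl⟩
    · exact mem_closedBall_self _ _
    · exact adj_adj_mem_closedBall_two hx (hl.1.open_at (hNl x hx)).1
  have hv2 := mem_closedBall_self (G := G) v 2
  have hI2 : ∀ c ∈ I, ∀ a ∈ I, a ∈ G.closedBall c 2 := by
    intro c hc a ha
    obtain ⟨w, hcw, haw⟩ := hG.exists_common (hIv c hc) (hIv a ha) hv2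
      (fun w hw => closedBall_mono v (by norm_num) (hIv w hw)) (by omega) (hind c hc) (hind a ha)
    exact adj_adj_mem_closedBall_two hcw haw.symm
  obtain ⟨z, hzI, hzmin⟩ := Finset.exists_min_image I
    (fun c => (G.ballGraph c 3).vertexConnectivity) ⟨v, hvI⟩
  have hI3 : ∀ c ∈ I, ∀ a ∈ I, a ∈ G.closedBall c 3 := fun c hc a ha =>
    closedBall_mono c (by norm_num) (hI2 c hc a ha)
  have hdeg : 0 < G.degree v := by
    have := hG.degree v v hv2
    have := hG.two_le v
    omega
  have hother : ∀ c ∈ I, ∃ b ∈ I, b ≠ c := fun c hc =>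
    Finset.exists_mem_ne (by omega) c
  obtain ⟨b, hbI, hbz⟩ := hother z hzI
  obtain ⟨b', hbI', hbv⟩ := hother v hvI
  have hkv : (G.ballGraph z 3).vertexConnectivity ≤ G.degree v :=
    vertexConnectivity_le_degree (hI2 z hzI v hvI) (hI3 z hzI b' hbI') hbv (hind v hvI b' hbI')
  obtain ⟨S, P, Q, hsep, hS⟩ := exists_isBallSeparation (hI3 z hzI z hzI) (hI3 z hzI b hbI)
    hbz.symm (hind z hzI b hbI)
  -- Here |S| = κ ≤ d(v) < |I|.
  obtain ⟨x, hxI, hxS⟩ : ∃ x ∈ I, x ∉ S := by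
    by_contra! h
    have : (I : Set V).ncard ≤ S.ncard := Set.ncard_le_ncard h
    rw [Set.ncard_coe_finset] at this
    omega
  clear hbI hbz hbI' hbv
  wlog hxP : x ∈ P generalizing P Q
  · refine this Q P hsep.symm ?_
    rcases hsep.union.ge (hI3 z hzI x hxI) with (h | h) | h
    · exact absurd h hxS
    · exact absurd h hxP
    · exact h
  have hcases : ∀ w ∈ G.closedBall z 3, w ∈ S ∨ w ∈ P ∨ w ∈ Q := fun w hw => by
    rcases hsep.union.ge hw with (h | h) | h <;> tauto
  have hSle : ∀ (T : Finset V), (∀ w ∈ T, w ∈ S) → T.card ≤ (G.ballGraph z 3).vertexConnectivity :=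
    fun T hT => by
      rw [← hS, ← Set.ncard_coe_finset]
      exact Set.ncard_le_ncard hT
  -- As |I| = d(v) + 1, a and x have at least κ + 1 common neighbours, which do not fit into S.
  have hIQ : ∀ a ∈ I, a ∉ Q := by
    intro a ha haQ
    have h1 := hG.card_inter (hI2 z hzI x hxI) (hI2 z hzI a ha) (hI2 z hzI v hvI) (hI3 z hzI)
      (hind x hxI)
    have h2 := hSle (G.neighborFinset a ∩ (G.neighborFinset x ∪ I)) (by
      intro w hw
      simp only [Finset.mem_inter, Finset.mem_union, mem_neighborFinset] at hw
      rcases hw.2 with h | h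
      · rcases hcases w (mem_closedBall_of_adj (hI2 z hzI x hxI) h) with h' | h' | h'
        · exact h'
        · exact absurd hw.1.symm (hsep.not_adj w h' a haQ)
        · exact absurd h (hsep.not_adj x hxP w h')
      · exact absurd hw.1 (hind a ha w h))
    omega
  -- The same count in the ball around c gives more than κ(G_3(c)) ≥ κ(G_3(z)) = |S| common
  -- neighbours of x and y, again all in S.
  have hQI : ∀ c ∈ I, ∀ y ∈ Q, y ∉ G.closedBall c 2 := by
    intro c hc y hy hyc
    have h1 := hG.card_inter (hI2 c hc x hxI) hyc (hI2 c hc v hvI) (hI3 c hc) (hind x hxI)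
    have h2 := hSle (G.neighborFinset y ∩ (G.neighborFinset x ∪ I)) (by
      intro w hw
      simp only [Finset.mem_inter, Finset.mem_union, mem_neighborFinset] at hw
      have hw3 : w ∈ G.closedBall z 3 := by
        rcases hw.2 with h | h
        · exact mem_closedBall_of_adj (hI2 z hzI x hxI) h
        · exact hI3 z hzI w h
      rcases hcases w hw3 with h' | h' | h'
      · exact h'
      · exact absurd hw.1.symm (hsep.not_adj w h' y hy)
      · rcases hw.2 with h | h
        · exact absurd h (hsep.not_adj x hxP w h')
        · exact absurd h' (hIQ w h))
    have h3 := hzmin c hc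
    omega
  obtain ⟨y, hyQ⟩ := hsep.nonempty_right
  have hy3 : y ∈ G.closedBall z 3 := hsep.union.le (Or.inr hyQ)
  obtain ⟨s, hsz, hsy⟩ := exists_adj_mem_closedBall hy3
    (by rintro rfl; exact hQI _ hzI _ hyQ (mem_closedBall_self _ _))
  have hsI : ∀ w ∈ I, ¬ G.Adj s w := by
    intro w hw h
    exact hQI w hw y hyQ (adj_adj_mem_closedBall_two h.symm hsy)
  obtain ⟨w, hvw, hsw⟩ := hG.exists_common (hI2 z hzI v hvI) hsz (hI2 z hzI v hvI) (hI3 z hzI)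
    (by omega) (hind v hvI) hsI
  have hvw1 : v ∈ G.closedBall w 1 := adj_mem_closedBall_one hvw.symm
  have hIw : ∀ a ∈ I, a ∈ G.closedBall w 3 := by
    intro a ha
    rcases (hmem a).1 ha with rfl | ⟨x, hx, rfl⟩
    · exact closedBall_mono w (by norm_num) hvw1
    · exact mem_closedBall_of_adj (mem_closedBall_of_adj hvw1 hx) (hl.1.open_at (hNl x hx)).1
  -- The ball is recentred at w, within distance 2 of both v and y and within 3 of all of `I`; a
  -- common neighbour of v and y then puts y at distance 2 from v, against `hQI`.
  obtain ⟨w', hvw', hyw'⟩ := hG.exists_common (closedBall_mono w (by norm_num) hvw1)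
    (adj_adj_mem_closedBall_two hsw.symm hsy) (closedBall_mono w (by norm_num) hvw1) hIw
    (by omega) (hind v hvI) (fun a ha h => hQI a ha y hyQ
      (closedBall_mono a (by norm_num) (adj_mem_closedBall_one h.symm)))
  exact hQI v hvI y hyQ (adj_adj_mem_closedBall_two hvw' hyw'.symm)

end LocalDegree

/-! ### The count for two attachments with close successors -/

section Counting

variable {V : Type*} [DecidableEq V] {G : SimpleGraph V}

theorem IsSeg.formPerm_mem {a b x : V} {l s t : List V} (hl : l.Nodup) (hr : l ~r s ++ t)
    (hs : G.IsSeg a b s) (hx : x ∈ s) (hxb : x ≠ b) : l.formPerm x ∈ s := by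
  obtain ⟨s₁, s₂, rfl, -, h2, -⟩ := hs.split_formPerm hl hr hx hxb
  exact List.mem_append_right _ h2.head_mem

/-- The predecessor, within a segment of a cyclic list, of a vertex other than the first. -/
theorem exists_formPerm_eq {x y v : V} {l s t : List V} (hl : l.Nodup) (hr : l ~r s ++ t)
    (ht : G.IsSeg (l.formPerm y) x t) (hv : v ∈ s)
    (hvx : v ≠ l.formPerm x) : ∃ u ∈ s, u ≠ y ∧ l.formPerm u = v := by
  have hdisj : ∀ w, w ∈ s → w ∉ t := fun w hw hw' =>
    (List.nodup_append.1 (hr.perm.nodup_iff.1 hl)).2.2 w hw w hw' rfl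
  obtain ⟨u, rfl⟩ := l.formPerm.surjective v
  have hul : u ∈ l := List.mem_of_formPerm_apply_mem
    (hr.perm.mem_iff.2 (List.mem_append_left _ hv))
  have hux : u ≠ x := fun h => hvx (h ▸ rfl)
  have hus : u ∈ s := by
    rcases List.mem_append.1 (hr.perm.mem_iff.1 hul) with h | h
    · exact h
    · exact absurd (ht.formPerm_mem hl (hr.trans List.isRotated_append) h hux) (hdisj _ hv)
  exact ⟨u, hus, fun h => hdisj _ hv (h ▸ ht.head_mem), rfl⟩

variable [Fintype V] [DecidableRel G.Adj]

/-- Two attachments `x` and `y` of a path off a longest cyclic list whose successors are at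
distance at most two contradict the local degree condition, provided the further neighbours on the
list of the first vertex of the path do not admit the exchanges excluded here. -/
theorem BallDegreeCondition.not_two_attachments (hG : G.BallDegreeCondition) {l P : List V}
    (hl : G.IsLongestCyclicList l) {p q x y : V} (hP : G.IsOffSeg l p q P) (hx : x ∈ l)
    (hy : y ∈ l) (hxy : x ≠ y) (hxp : G.Adj x p) (hyq : G.Adj y q)
    (hball : l.formPerm y ∈ G.closedBall (l.formPerm x) 2)
    (hmiss : ∀ u ∈ l, G.Adj p u → u ≠ x → u ≠ y → l.formPerm u ∈ G.closedBall (l.formPerm x) 2 ∧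
      ((∃ w, w ∉ l ∧ G.Adj (l.formPerm u) w) ∨
        (¬ G.Adj (l.formPerm x) (l.formPerm (l.formPerm u)) ∧
          ¬ G.Adj (l.formPerm y) (l.formPerm (l.formPerm u))))) : False := by
  have hpl : p ∉ l := hP.2.2 p hP.1.head_mem
  have hPp := IsOffSeg.singleton (G := G) hpl
  have hnd := hl.1.1
  obtain ⟨s, t, hr, hs, ht⟩ := hl.1.open_at_two hx hy hxy
  have hr' := hr.trans List.isRotated_append
  have hdisj : ∀ w, w ∈ s → w ∉ t := fun w hw hw' =>
    (List.nodup_append.1 (hr.perm.nodup_iff.1 hnd)).2.2 w hw w hw' rfl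
  have hsl : ∀ w ∈ s, w ∈ l := fun w hw => hr.perm.mem_iff.2 (List.mem_append_left _ hw)
  have htl : ∀ w ∈ t, w ∈ l := fun w hw => hr.perm.mem_iff.2 (List.mem_append_right _ hw)
  have hlst : ∀ w ∈ l, w ∈ s ∨ w ∈ t := fun w hw => List.mem_append.1 (hr.perm.mem_iff.1 hw)
  have hsucc : ∀ w ∈ l, G.Adj w (l.formPerm w) := fun w hw => (hl.1.open_at hw).1
  have hσl : ∀ w ∈ l, l.formPerm w ∈ l := fun w hw => IsCyclicList.formPerm_mem hw
  have hcross₁ : ∀ a ∈ s, a ≠ y → G.Adj (l.formPerm y) a →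
      ¬ G.Adj (l.formPerm x) (l.formPerm a) := fun a ha hay h =>
    hl.not_cross hP hxp hyq hr hs ht ha hay h
  have hcross₂ : ∀ a ∈ t, a ≠ x → G.Adj (l.formPerm x) a →
      ¬ G.Adj (l.formPerm y) (l.formPerm a) := fun a ha hax h =>
    hl.not_cross hP.reverse hyq hxp hr' ht hs ha hax h
  have hoff : ∀ r, (r = p ∨ (G.Adj p r ∧ r ∉ l)) → r ∉ l ∧ (∀ u ∈ l, G.Adj p u →
      ¬ G.Adj r (l.formPerm u)) ∧ ¬ G.Adj r (l.formPerm y) := by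
    intro r hr
    have h1 : ∃ P', G.IsOffSeg l p r P' := by
      rcases hr with rfl | ⟨h, h'⟩
      · exact ⟨_, hPp⟩
      · exact ⟨_, IsOffSeg.pair hpl h' h⟩
    have h2 : ∃ P', G.IsOffSeg l q r P' := by
      rcases hr with rfl | ⟨h, h'⟩
      · exact ⟨_, hP.reverse⟩
      · exact hP.reverse.exists_of_adj h h'
    obtain ⟨P₁, hP₁⟩ := h1
    obtain ⟨P₂, hP₂⟩ := h2
    exact ⟨hP₁.2.2 r hP₁.1.last_mem, fun u hu hpu => hl.not_adj_succ hP₁ hu hpu.symm,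
      hl.not_adj_succ hP₂ hy hyq⟩
  set X := ((G.neighborFinset p).filter (· ∈ l)).erase x |>.erase y with hX
  have hXmem : ∀ u, u ∈ X → u ≠ y ∧ u ≠ x ∧ G.Adj p u ∧ u ∈ l := by
    intro u hu; simpa [hX] using hu
  have hXp : ∀ u ∈ X, ∀ v ∈ l, G.Adj p v → l.formPerm u ≠ v := by
    intro u hu v hv hpv h
    obtain ⟨-, -, h1, h2⟩ := hXmem u hu
    exact hl.not_adj_succ hPp h2 h1.symm (h ▸ hpv)
  have hXy : ∀ u ∈ X, l.formPerm u ≠ y := by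
    intro u hu h
    obtain ⟨-, -, h1, h2⟩ := hXmem u hu
    exact hl.not_adj_succ hP h2 h1.symm (h ▸ hyq.symm)
  -- The substitute for u is a neighbour of u⁺ off the list if there is one, and otherwise u⁺. If u⁺
  -- is already counted in `T₂`, it is replaced by u⁺⁺.
  have hex : ∀ u ∈ X, ∃ m, (m ∉ l ∧ G.Adj (l.formPerm u) m) ∨
      (m = l.formPerm u ∧ ¬ (u ∈ t ∧ G.Adj (l.formPerm x) u) ∧
        ¬ G.Adj (l.formPerm x) (l.formPerm (l.formPerm u))) ∨
      (m = l.formPerm (l.formPerm u) ∧ u ∈ t ∧ G.Adj (l.formPerm x) u ∧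
        ¬ G.Adj (l.formPerm y) (l.formPerm (l.formPerm u))) := by
    intro u hu
    obtain ⟨h1, h2, h3, h4⟩ := hXmem u hu
    rcases (hmiss u h4 h3 h2 h1).2 with ⟨w, hw⟩ | ⟨h5, h6⟩
    · exact ⟨w, Or.inl hw⟩
    · by_cases h : u ∈ t ∧ G.Adj (l.formPerm x) u
      · exact ⟨_, Or.inr (Or.inr ⟨rfl, h.1, h.2, h6⟩)⟩
      · exact ⟨_, Or.inr (Or.inl ⟨rfl, h, h5⟩)⟩
  choose! m hm using hex
  have hml : ∀ u ∈ X, m u ∈ l → m u = l.formPerm u ∨ m u = l.formPerm (l.formPerm u) := by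
    intro u hu h
    rcases hm u hu with h' | h' | h'
    · exact absurd h h'.1
    · exact Or.inl h'.1
    · exact Or.inr h'.1
  have hminj : Set.InjOn m X := by
    intro u hu v hv huv
    obtain ⟨-, -, hpu, hul⟩ := hXmem u hu
    obtain ⟨-, -, hpv, hvl⟩ := hXmem v hv
    by_contra hne
    rcases hm u hu with h | h | h <;> rcases hm v hv with h' | h' | h'
    · exact hl.not_common_succ hPp hul hvl hne hpu.symm hpv.symm h.1 h.2 (huv ▸ h'.2)
    · exact h.1 (huv ▸ h'.1 ▸ hσl _ hvl)
    · exact h.1 (huv ▸ h'.1 ▸ hσl _ (hσl _ hvl))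
    · exact h'.1 (huv ▸ h.1 ▸ hσl _ hul)
    · exact hne (l.formPerm.injective (by rw [← h.1, ← h'.1, huv]))
    · exact hXp v hv u hul hpu (l.formPerm.injective (by rw [← h.1, ← h'.1, huv])).symm
    · exact h'.1 (huv ▸ h.1 ▸ hσl _ (hσl _ hul))
    · exact hXp u hu v hvl hpv (l.formPerm.injective (by rw [← h.1, ← h'.1, huv]))
    · exact hne (l.formPerm.injective (l.formPerm.injective (by rw [← h.1, ← h'.1, huv])))
  -- Neighbours of x⁺ are shifted back on `s` and forward on `t`, so that `hcross₁` and `hcross₂`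
  -- make them disjoint from N(y⁺). Only the possible neighbour x is lost.
  set T₁ := s.toFinset.filter (fun a => a ≠ y ∧ G.Adj (l.formPerm x) (l.formPerm a)) with hT₁
  set T₂ := ((t.toFinset.filter (fun a => G.Adj (l.formPerm x) a)).erase x).image l.formPerm
    with hT₂
  set O := (G.neighborFinset (l.formPerm x)).filter (· ∉ l) with hO
  set N := insert p ((G.neighborFinset p).filter (· ∉ l)) with hN
  have memT₁ : ∀ v, v ∈ T₁ → v ∈ s ∧ v ≠ y ∧ G.Adj (l.formPerm x) (l.formPerm v) := by
    intro v hv; simpa [hT₁] using hv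
  have memT₂ : ∀ v, v ∈ T₂ → ∃ u, u ≠ x ∧ u ∈ t ∧ G.Adj (l.formPerm x) u ∧ l.formPerm u = v := by
    intro v hv
    simp only [hT₂, Finset.mem_image, Finset.mem_erase, Finset.mem_filter, List.mem_toFinset] at hv
    obtain ⟨u, ⟨h1, h2, h3⟩, h4⟩ := hv
    exact ⟨u, h1, h2, h3, h4⟩
  have memO : ∀ v, v ∈ O → G.Adj (l.formPerm x) v ∧ v ∉ l := by
    intro v hv; simpa [hO] using hv
  have memN : ∀ v, v ∈ N → v = p ∨ (G.Adj p v ∧ v ∉ l) := by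
    intro v hv; simpa [hN] using hv
  have hT₂t : ∀ v ∈ T₂, v ∈ t := by
    intro v hv
    obtain ⟨u, h1, h2, -, rfl⟩ := memT₂ v hv
    exact ht.formPerm_mem hnd hr' h2 h1
  have cardT₁ : ((G.neighborFinset (l.formPerm x)).filter (· ∈ s)).card ≤ T₁.card := by
    refine (Finset.card_le_card ?_).trans (Finset.card_image_le (s := T₁) (f := l.formPerm))
    intro v hv
    simp only [Finset.mem_filter, mem_neighborFinset] at hv
    obtain ⟨u, hu, huy, rfl⟩ := exists_formPerm_eq hnd hr ht hv.2 hv.1.ne'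
    exact Finset.mem_image_of_mem _ (by simp [hT₁, hu, huy, hv.1])
  have cardT₂ : ((G.neighborFinset (l.formPerm x)).filter (· ∈ t)).card ≤ T₂.card + 1 := by
    rw [hT₂, Finset.card_image_of_injective _ l.formPerm.injective]
    have h1 := Finset.pred_card_le_card_erase (a := x)
      (s := t.toFinset.filter (fun a => G.Adj (l.formPerm x) a))
    have h2 : (G.neighborFinset (l.formPerm x)).filter (· ∈ t) =
        t.toFinset.filter (fun a => G.Adj (l.formPerm x) a) := by
      ext v; simp [and_comm]
    rw [h2]
    omega
  have cardσx : G.degree (l.formPerm x) ≤ T₁.card + T₂.card + 1 + O.card := by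
    rw [← card_neighborFinset_eq_degree]
    have : G.neighborFinset (l.formPerm x) ⊆
        (G.neighborFinset (l.formPerm x)).filter (· ∈ s) ∪
        (G.neighborFinset (l.formPerm x)).filter (· ∈ t) ∪ O := by
      intro v hv
      simp only [Finset.mem_union, Finset.mem_filter, hO]
      by_cases hvl : v ∈ l
      · rcases hlst v hvl with h | h <;> tauto
      · tauto
    have h1 := Finset.card_le_card this
    have h2 := Finset.card_union_le ((G.neighborFinset (l.formPerm x)).filter (· ∈ s) ∪
        (G.neighborFinset (l.formPerm x)).filter (· ∈ t)) O
    have h3 := Finset.card_union_le ((G.neighborFinset (l.formPerm x)).filter (· ∈ s))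
        ((G.neighborFinset (l.formPerm x)).filter (· ∈ t))
    omega
  have cardp : G.degree p + 1 ≤ N.card + X.card + 2 := by
    rw [← card_neighborFinset_eq_degree, ← Finset.card_filter_add_card_filter_not (· ∈ l), hN,
      Finset.card_insert_of_notMem (by simp), hX]
    have h1 := Finset.pred_card_le_card_erase (a := x)
      (s := (G.neighborFinset p).filter (· ∈ l))
    have h2 := Finset.pred_card_le_card_erase (a := y)
      (s := ((G.neighborFinset p).filter (· ∈ l)).erase x)
    omega
  have hσyl := hσl y hy
  have d₁ : Disjoint T₁ T₂ := Finset.disjoint_left.2 fun v h h' =>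
    hdisj v (memT₁ v h).1 (hT₂t v h')
  have d₂ : l.formPerm y ∉ T₁ ∪ T₂ := by
    rw [Finset.mem_union]
    rintro (h | h)
    · exact hdisj _ (memT₁ _ h).1 ht.head_mem
    · obtain ⟨u, -, h2, -, h4⟩ := memT₂ _ h
      exact hdisj _ hs.last_mem (l.formPerm.injective h4 ▸ h2)
  set A := insert (l.formPerm y) (T₁ ∪ T₂) with hA
  have hAl : ∀ v ∈ A, v ∈ l := by
    intro v hv
    rw [hA, Finset.mem_insert, Finset.mem_union] at hv
    rcases hv with rfl | h | h
    · exact hσyl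
    · exact hsl _ (memT₁ _ h).1
    · exact htl _ (hT₂t _ h)
  have d₃ : Disjoint A O := Finset.disjoint_left.2 fun v h h' => (memO v h').2 (hAl v h)
  have d₄ : Disjoint (A ∪ O) (G.neighborFinset (l.formPerm y)) := by
    rw [Finset.disjoint_left]
    intro v h h'
    rw [mem_neighborFinset] at h'
    rw [hA, Finset.mem_union, Finset.mem_insert, Finset.mem_union] at h
    rcases h with (rfl | h | h) | h
    · exact G.irrefl h'
    · obtain ⟨h1, h2, h3⟩ := memT₁ v h
      exact hcross₁ v h1 h2 h' h3
    · obtain ⟨u, h1, h2, h3, rfl⟩ := memT₂ v h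
      exact hcross₂ u h2 h1 h3 h'
    · exact hl.not_common_succ hP hx hy hxy hxp hyq (memO v h).2 (memO v h).1 h'
  have d₅ : Disjoint (A ∪ O ∪ G.neighborFinset (l.formPerm y)) N := by
    rw [Finset.disjoint_left]
    intro v h h'
    obtain ⟨h1, h2, h3⟩ := hoff v (memN v h')
    rw [Finset.mem_union, Finset.mem_union, mem_neighborFinset] at h
    rcases h with (h | h) | h
    · exact h1 (hAl v h)
    · exact h2 x hx hxp.symm (memO v h).1.symm
    · exact h3 h.symm
  have d₆ : Disjoint (A ∪ O ∪ G.neighborFinset (l.formPerm y) ∪ N) (X.image m) := by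
    rw [Finset.disjoint_right]
    intro v h h'
    obtain ⟨u, hu, rfl⟩ := Finset.mem_image.1 h
    obtain ⟨huy, hux, hpu, hul⟩ := hXmem u hu
    have hux' := hl.not_adj_succ_succ hPp hx hul hux.symm hxp hpu.symm
    have huy' := hl.not_adj_succ_succ hP hul hy huy hpu.symm hyq
    rw [Finset.mem_union, Finset.mem_union, Finset.mem_union, mem_neighborFinset] at h'
    rcases hm u hu with ⟨h1, h2⟩ | ⟨h1, h2, h3⟩ | ⟨h1, h2, h3, h4⟩
    · rcases h' with ((h' | h') | h') | h'
      · exact h1 (hAl _ h')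
      · exact hl.not_common_succ hPp hul hx hux hpu.symm hxp h1 h2 (memO _ h').1
      · exact hl.not_common_succ hP hul hy huy hpu.symm hyq h1 h2 h'
      · exact (hoff _ (memN _ h')).2.1 u hul hpu h2.symm
    · rw [h1] at h'
      rw [hA, Finset.mem_insert, Finset.mem_union] at h'
      rcases h' with (((h' | h' | h') | h') | h') | h'
      · exact huy (l.formPerm.injective h')
      · exact h3 (memT₁ _ h').2.2
      · obtain ⟨a, k1, k2, k3, k4⟩ := memT₂ _ h'
        obtain rfl := l.formPerm.injective k4
        exact h2 ⟨k2, k3⟩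
      · exact (memO _ h').2 (hσl _ hul)
      · exact huy' h'.symm
      · exact (hoff _ (memN _ h')).1 (hσl _ hul)
    · rw [h1] at h'
      rw [hA, Finset.mem_insert, Finset.mem_union] at h'
      rcases h' with (((h' | h' | h') | h') | h') | h'
      · exact hXy u hu (l.formPerm.injective h')
      · have k1 := ht.formPerm_mem hnd hr' h2 hux
        have k2 := ht.formPerm_mem hnd hr' k1 (hXp u hu x hx hxp.symm)
        exact hdisj _ (memT₁ _ h').1 k2
      · obtain ⟨a, -, -, k3, k4⟩ := memT₂ _ h'
        obtain rfl := l.formPerm.injective k4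
        exact hux' k3
      · exact (memO _ h').2 (hσl _ (hσl _ hul))
      · exact h4 h'
      · exact (hoff _ (memN _ h')).1 (hσl _ (hσl _ hul))
  have hx2 := mem_closedBall_self (G := G) (l.formPerm x) 2
  have hp2 : p ∈ G.closedBall (l.formPerm x) 2 := adj_adj_mem_closedBall_two (hsucc x hx).symm hxp
  have hle : (A ∪ O ∪ G.neighborFinset (l.formPerm y) ∪ N ∪ X.image m).card ≤
      (G.closedBall (l.formPerm x) 3).ncard := by
    apply card_le_ncard_closedBall
    intro v hv
    simp only [hA, Finset.mem_union, Finset.mem_insert] at hv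
    rcases hv with ((((rfl | h | h) | h) | h) | h) | h
    · exact closedBall_mono _ (by norm_num) hball
    · obtain ⟨h1, -, h3⟩ := memT₁ v h
      exact closedBall_mono _ (by norm_num)
        (adj_adj_mem_closedBall_two h3 (hsucc v (hsl v h1)).symm)
    · obtain ⟨u, -, h2, h3, rfl⟩ := memT₂ v h
      exact closedBall_mono _ (by norm_num) (adj_adj_mem_closedBall_two h3 (hsucc u (htl u h2)))
    · exact closedBall_mono _ (by norm_num) (adj_mem_closedBall_one (memO v h).1)
    · exact mem_closedBall_of_mem_neighborFinset hball h
    · rcases memN v h with rfl | h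
      · exact closedBall_mono _ (by norm_num) hp2
      · exact mem_closedBall_of_adj hp2 h.1
    · obtain ⟨u, hu, rfl⟩ := Finset.mem_image.1 h
      obtain ⟨huy, hux, hpu, hul⟩ := hXmem u hu
      have hu2 := (hmiss u hul hpu hux huy).1
      rcases hm u hu with ⟨h1, h2⟩ | ⟨h1, -⟩ | ⟨h1, -⟩
      · exact mem_closedBall_of_adj hu2 h2
      · rw [h1]; exact closedBall_mono _ (by norm_num) hu2
      · rw [h1]; exact mem_closedBall_of_adj hu2 (hsucc _ (hσl _ hul))
  -- The sets have at least (d(x⁺) - 1) + 1 + d(y⁺) + (d(p) - 1) elements: x is lost from N(x⁺), y⁺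
  -- is gained, and p is gained while x and y are missing from `X`. By the degree condition this is
  -- at least |M_3(x⁺)| + κ - 1, which exceeds |M_3(x⁺)| because κ ≥ 2.
  rw [Finset.card_union_of_disjoint d₆, Finset.card_union_of_disjoint d₅,
    Finset.card_union_of_disjoint d₄, Finset.card_union_of_disjoint d₃, hA,
    Finset.card_insert_of_notMem d₂, Finset.card_union_of_disjoint d₁,
    Finset.card_image_of_injOn hminj, card_neighborFinset_eq_degree] at hle
  have h1 := hG.degree _ _ hx2
  have h2 := hG.degree _ _ hball
  have h3 := hG.degree _ _ hp2
  have h4 := hG.two_le (l.formPerm x)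
  omega

end Counting

/-! ### Unique attachments and the spanning cycle -/

section Hamiltonicity

variable {V : Type*} {G : SimpleGraph V}

/-- The graph obtained from `G` by isolating the vertices of `l`. -/
def offGraph (G : SimpleGraph V) (l : List V) : SimpleGraph V where
  Adj a b := G.Adj a b ∧ a ∉ l ∧ b ∉ l
  symm := ⟨fun _ _ h => ⟨h.1.symm, h.2.2, h.2.1⟩⟩
  loopless := ⟨fun _ h => G.irrefl h.1⟩

theorem exists_isOffSeg_of_reachable {l : List V} {p q : V} (hp : p ∉ l)
    (h : (G.offGraph l).Reachable p q) : ∃ P, G.IsOffSeg l p q P := by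
  obtain ⟨w⟩ := h
  induction w using Walk.concatRec with
  | Hnil => exact ⟨_, IsOffSeg.singleton hp⟩
  | Hconcat w hadj ih =>
    obtain ⟨P, hP⟩ := ih hp
    exact hP.exists_of_adj hadj.1 hadj.2.2

variable [DecidableEq V] [Fintype V] [DecidableRel G.Adj]

/-- Under the local degree condition, a vertex off a longest cyclic list has at most one neighbour
on the list. -/
theorem BallDegreeCondition.attachment_unique (hG : G.BallDegreeCondition) {l : List V}
    (hl : G.IsLongestCyclicList l) {p x y : V} (hp : p ∉ l) (hx : x ∈ l) (hy : y ∈ l)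
    (hpx : G.Adj p x) (hpy : G.Adj p y) : x = y := by
  by_contra hxy
  have hP := IsOffSeg.singleton (G := G) hp
  have hp2 := mem_closedBall_self (G := G) p 2
  have hσ2 : ∀ u ∈ l, G.Adj p u → l.formPerm u ∈ G.closedBall p 2 := fun u hu hpu =>
    adj_adj_mem_closedBall_two hpu (hl.1.open_at hu).1
  set X := (G.neighborFinset p).filter (· ∈ l) with hX
  set N := insert p ((G.neighborFinset p).filter (· ∉ l)) with hN
  have memX : ∀ u, u ∈ X ↔ G.Adj p u ∧ u ∈ l := by intro u; simp [hX]
  have memN : ∀ u, u ∈ N ↔ u = p ∨ (G.Adj p u ∧ u ∉ l) := by intro u; simp [hN]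
  have hdisj : Disjoint (X.image l.formPerm) N := by
    rw [Finset.disjoint_left]
    intro v h h'
    obtain ⟨u, hu, rfl⟩ := Finset.mem_image.1 h
    have := IsCyclicList.formPerm_mem ((memX u).1 hu).2
    rcases (memN _).1 h' with h' | h'
    · exact hp (h' ▸ this)
    · exact h'.2 this
  have hcard : G.degree p ≤ (X.image l.formPerm ∪ N).card := by
    rw [Finset.card_union_of_disjoint hdisj,
      Finset.card_image_of_injective _ l.formPerm.injective, hN, hX,
      Finset.card_insert_of_notMem (by simp), ← card_neighborFinset_eq_degree,
      ← Finset.card_filter_add_card_filter_not (· ∈ l)]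
    omega
  have hI : ∀ w ∈ X.image l.formPerm ∪ N, w ∈ G.closedBall p 3 := by
    intro w hw
    rcases Finset.mem_union.1 hw with h | h
    · obtain ⟨u, hu, rfl⟩ := Finset.mem_image.1 h
      exact closedBall_mono p (by norm_num) (hσ2 u ((memX u).1 hu).2 ((memX u).1 hu).1)
    · rcases (memN w).1 h with rfl | h
      · exact mem_closedBall_self _ _
      · exact closedBall_mono p (by norm_num) (adj_mem_closedBall_one h.1)
  have hnadj : ∀ u ∈ l, G.Adj p u → ∀ w ∈ X.image l.formPerm ∪ N,
      ¬ G.Adj (l.formPerm u) w := by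
    intro u hu hpu w hw
    rcases Finset.mem_union.1 hw with h | h
    · obtain ⟨v, hv, rfl⟩ := Finset.mem_image.1 h
      rw [memX] at hv
      by_cases huv : u = v
      · rw [huv]; exact G.irrefl
      · exact hl.not_adj_succ_succ hP hu hv.2 huv hpu.symm hv.1.symm
    · rcases (memN w).1 h with rfl | h
      · exact fun h => hl.not_adj_succ hP hu hpu.symm h.symm
      · exact fun h' => hl.not_adj_succ (IsOffSeg.pair hp h.2 h.1) hu hpu.symm h'.symm
  have hcommon : ∀ u ∈ l, G.Adj p u → l.formPerm u ∈ G.closedBall (l.formPerm x) 2 := by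
    intro u hu hpu
    obtain ⟨w, h1, h2⟩ := hG.exists_common (hσ2 x hx hpx) (hσ2 u hu hpu) hp2 hI hcard
      (hnadj x hx hpx) (hnadj u hu hpu)
    exact adj_adj_mem_closedBall_two h1 h2.symm
  refine hG.not_two_attachments hl hP hx hy hxy hpx.symm hpy.symm (hcommon y hy hpy)
    fun u hu hpu hux huy => ⟨hcommon u hu hpu, ?_⟩
  by_contra! hcon
  obtain ⟨hno, himp⟩ := hcon
  obtain ⟨z, hz, hpz, hzu, hadj⟩ : ∃ z ∈ l, G.Adj p z ∧ z ≠ u ∧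
      G.Adj (l.formPerm z) (l.formPerm (l.formPerm u)) := by
    by_cases h : G.Adj (l.formPerm x) (l.formPerm (l.formPerm u))
    · exact ⟨x, hx, hpx, hux.symm, h⟩
    · exact ⟨y, hy, hpy, huy.symm, himp h⟩
  -- Exchanging p for u⁺ gives another longest cycle, now missing u⁺. The neighbour of u⁺ off that
  -- cycle is also off `l`, contradicting `hno`.
  obtain ⟨l', hl', hmem⟩ := hl.exists_exchange hp hz hu hzu hpz.symm hpu.symm hadj
  have hσu : l.formPerm u ∉ l' := by
    rw [hmem]
    rintro (h | h)
    · exact hp (h ▸ IsCyclicList.formPerm_mem hu)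
    · exact h.2 rfl
  obtain ⟨w, hw, hadj'⟩ := hG.exists_adj_off hl' hσu
  exact hno w (fun hwl => hw ((hmem w).2 (Or.inr ⟨hwl, hadj'.ne'⟩))) hadj'

/-- Under the local degree condition, if all balls of radius `3` are 2-connected, a longest cyclic
list contains all vertices. -/
theorem BallDegreeCondition.mem_longest (hG : G.BallDegreeCondition) (hconn : G.Connected)
    (hball : ∀ v, (G.ballGraph v 3).IsVertexConnected 2) {l : List V}
    (hl : G.IsLongestCyclicList l) (v : V) : v ∈ l := by
  by_contra hv
  obtain ⟨a, ha⟩ := List.exists_mem_of_ne_nil l hl.1.ne_nil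
  obtain ⟨w⟩ := hconn.preconnected v a
  obtain ⟨⟨⟨p, x⟩, hpx⟩, -, hp, hx⟩ := w.exists_boundary_dart {v | v ∉ l} hv (not_not.2 ha)
  simp only [Set.mem_ofPred_eq, not_not] at hp hx hpx
  set R : Set V := {q | (G.offGraph l).Reachable p q} with hR
  have hRP : ∀ q ∈ R, ∃ P, G.IsOffSeg l p q P := fun q hq => exists_isOffSeg_of_reachable hp hq
  have hRl : ∀ q ∈ R, q ∉ l := fun q hq => by
    obtain ⟨P, hP⟩ := hRP q hq
    exact hP.2.2 q hP.1.last_mem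
  have hRadj : ∀ q ∈ R, ∀ r, r ∉ l → G.Adj q r → r ∈ R := fun q hq r hr hqr =>
    Reachable.trans hq (Adj.reachable ⟨hqr, hRl q hq, hr⟩)
  have hpR : p ∈ R := Reachable.refl p
  have hsucc : ∀ w ∈ l, G.Adj w (l.formPerm w) := fun w hw => (hl.1.open_at hw).1
  have hσR : ∀ u ∈ l, (∃ r ∈ R, G.Adj r u) → ∀ q ∈ R, ¬ G.Adj (l.formPerm u) q := by
    rintro u hu ⟨r, hr, hru⟩ q hq h
    obtain ⟨P, hP⟩ := exists_isOffSeg_of_reachable (hRl r hr)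
      (Reachable.trans (Reachable.symm hr) hq)
    exact hl.not_adj_succ hP hu hru.symm h.symm
  -- Since r has at most one neighbour on the list, r and its neighbours in R number at least d(r).
  -- They serve as the set of common nonneighbours in `exists_common`.
  have hN : ∀ r ∈ R, ∃ N : Finset V, G.degree r ≤ N.card ∧ (∀ w ∈ N, w ∈ R) ∧
      (∀ w ∈ N, w = r ∨ G.Adj r w) := by
    intro r hr
    refine ⟨insert r ((G.neighborFinset r).filter (· ∉ l)), ?_, ?_, ?_⟩
    · rw [Finset.card_insert_of_notMem (by simp), ← card_neighborFinset_eq_degree,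
        ← Finset.card_filter_add_card_filter_not (· ∈ l)]
      have : ((G.neighborFinset r).filter (· ∈ l)).card ≤ 1 := by
        rw [Finset.card_le_one]
        intro a ha b hb
        simp only [Finset.mem_filter, mem_neighborFinset] at ha hb
        exact hG.attachment_unique hl (hRl r hr) ha.2 hb.2 ha.1 hb.1
      omega
    · intro w hw
      simp only [Finset.mem_insert, Finset.mem_filter, mem_neighborFinset] at hw
      rcases hw with rfl | hw
      · exact hr
      · exact hRadj r hr w hw.2 hw.1
    · intro w hw
      simp only [Finset.mem_insert, Finset.mem_filter, mem_neighborFinset] at hw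
      tauto
  obtain ⟨y, y₁, hy, hyx, r, hr, hry, hyy₁, hy₁x, hy₁B, hy₁R, hy₁N⟩ : ∃ y y₁, y ∈ l ∧ y ≠ x ∧
      ∃ r ∈ R, G.Adj r y ∧ G.Adj y y₁ ∧ y₁ ≠ x ∧ y₁ ∈ G.closedBall x 3 ∧ y₁ ∉ R ∧
        ∀ q ∈ R, ¬ G.Adj y₁ q := by
    have hpB : p ∈ G.closedBall x 3 :=
      closedBall_mono x (by norm_num) (adj_mem_closedBall_one hpx.symm)
    have hσB : l.formPerm x ∈ G.closedBall x 3 :=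
      closedBall_mono x (by norm_num) (adj_mem_closedBall_one (hsucc x hx))
    have hc := (hball x).2 {⟨x, mem_closedBall_self x 3⟩} (by simp)
    obtain ⟨w⟩ := hc.preconnected ⟨⟨p, hpB⟩, by simpa using hpx.ne⟩
      ⟨⟨l.formPerm x, hσB⟩, by simpa using (hsucc x hx).ne'⟩
    -- A walk avoiding x leads from p to x⁺, which lies neither in R nor among the attachments of R.
    -- The edge where it leaves their union starts at a second attachment y.
    obtain ⟨d, -, hd1, hd2⟩ := w.exists_boundary_dart
      {v | v.1.1 ∈ R ∨ (v.1.1 ∈ l ∧ ∃ r ∈ R, G.Adj r v.1.1)} (Or.inl hpR) (by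
        rintro (h | ⟨-, q, hq, h⟩)
        · exact hRl _ h (IsCyclicList.formPerm_mem hx)
        · exact hσR x hx ⟨p, hpR, hpx⟩ q hq h.symm)
    have hadj : G.Adj d.fst.1.1 d.snd.1.1 := d.adj
    have h1x : d.fst.1.1 ≠ x := by simpa [Subtype.ext_iff] using d.fst.2
    have h2x : d.snd.1.1 ≠ x := by simpa [Subtype.ext_iff] using d.snd.2
    have h2B := d.snd.1.2
    simp only [Set.mem_ofPred_eq, not_or, not_and, not_exists] at hd1 hd2
    rcases hd1 with h | ⟨h, q, hq, hqd⟩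
    · exfalso
      by_cases h' : d.snd.1.1 ∈ l
      · exact hd2.2 h' _ h hadj
      · exact hd2.1 (hRadj _ h _ h' hadj)
    · refine ⟨_, _, h, h1x, q, hq, hqd, hadj, h2x, h2B, hd2.1, fun q' hq' h' => ?_⟩
      by_cases h2l : d.snd.1.1 ∈ l
      · exact hd2.2 h2l q' hq' h'.symm
      · exact hd2.1 (hRadj q' hq' _ h2l h'.symm)
  -- The vertex y₁ may be at distance 3 from x, so the count is centred at the next vertex t on the
  -- way, with x⁺, y₁ and p all within distance 2 of t.
  obtain ⟨t, htx, hty⟩ : ∃ t, G.Adj x t ∧ y₁ ∈ G.closedBall t 2 := by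
    obtain ⟨t, ht, hadj⟩ := exists_adj_mem_closedBall (mem_closedBall_comm.1 hy₁B) hy₁x.symm
    exact ⟨t, hadj.symm, mem_closedBall_comm.1 ht⟩
  obtain ⟨N, hNcard, hNR, hNadj⟩ := hN p hpR
  have hpt : p ∈ G.closedBall t 2 := adj_adj_mem_closedBall_two htx.symm hpx.symm
  obtain ⟨w, hxw, hyw⟩ := hG.exists_common
    (adj_adj_mem_closedBall_two htx.symm (hsucc x hx)) hty hpt
    (fun w hw => by
      rcases hNadj w hw with rfl | h
      · exact closedBall_mono t (by norm_num) hpt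
      · exact mem_closedBall_of_adj hpt h) hNcard
    (fun w hw => hσR x hx ⟨p, hpR, hpx⟩ w (hNR w hw)) (fun w hw => hy₁N w (hNR w hw))
  obtain ⟨N', hNcard', hNR', hNadj'⟩ := hN r hr
  have hry₁ : r ∈ G.closedBall y₁ 2 := adj_adj_mem_closedBall_two hyy₁.symm hry.symm
  -- The common neighbour w of x⁺ and y₁ puts x⁺ within distance 2 of y₁, as y⁺ and r are through y;
  -- the ball around y₁ then gives x⁺ and y⁺ a common neighbour.
  obtain ⟨w', hxw', hyw'⟩ := hG.exists_common
    (adj_adj_mem_closedBall_two hyw hxw.symm)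
    (adj_adj_mem_closedBall_two hyy₁.symm (hsucc y hy)) hry₁
    (fun w hw => by
      rcases hNadj' w hw with rfl | h
      · exact closedBall_mono y₁ (by norm_num) hry₁
      · exact mem_closedBall_of_adj hry₁ h) hNcard'
    (fun w hw => hσR x hx ⟨p, hpR, hpx⟩ w (hNR' w hw))
    (fun w hw => hσR y hy ⟨r, hr, hry⟩ w (hNR' w hw))
  obtain ⟨P, hP⟩ := hRP r hr
  exact hG.not_two_attachments hl hP hx hy hyx.symm hpx.symm hry.symm
    (adj_adj_mem_closedBall_two hxw' hyw'.symm) fun u hu hpu hux _ =>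
      absurd (hG.attachment_unique hl hp hu hx hpu hpx) hux

end Hamiltonicity

end SimpleGraph

theorem mainTheorem6 {V : Type*} [Fintype V] [DecidableEq V]
    (G : SimpleGraph V) [DecidableRel G.Adj]
    (hconn : G.Connected) (hcard : 3 ≤ Fintype.card V)
    (hball : ∀ v : V, (G.ballGraph v 3).IsVertexConnected 2)
    (hdeg : ∀ v u : V, G.IsInteriorVertex v 3 u →
      (1 / 3 : ℚ) * (((G.closedBall v 3).ncard : ℚ) +
        ((G.ballGraph v 3).vertexConnectivity : ℚ)) ≤ (G.degree u : ℚ)) :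
    G.IsHamiltonian := by
  have hG : G.BallDegreeCondition := by
    refine ⟨fun c => SimpleGraph.two_le_vertexConnectivity (hball c), fun c u hu => ?_⟩
    have h := hdeg c u (SimpleGraph.isInteriorVertex_of_mem_closedBall hu)
    have h' : (((G.closedBall c 3).ncard + (G.ballGraph c 3).vertexConnectivity : ℕ) : ℚ) ≤
        ((3 * G.degree u : ℕ) : ℚ) := by
      push_cast
      linarith
    exact_mod_cast h'
  have : Nontrivial V := Fintype.one_lt_card_iff_nontrivial.1 (by omega)
  obtain ⟨a⟩ := hconn.nonempty
  obtain ⟨b, hab⟩ := hconn.preconnected.exists_adj_of_nontrivial a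
  obtain ⟨l, hl⟩ := SimpleGraph.exists_isLongestCyclicList hab
  exact hl.1.isHamiltonian (hG.mem_longest hconn hball hl) hcard
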